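/- Let $\mathrm E=\{(0)\}\cup\{(ij):1\le i<j\le5\}\cup\{(k):1\le k\le5\}$ (16 elements) and $\hat{\mathrm E}=\mathrm E\times\mathbb Z$; write $\alpha^r$ for $(\alpha,r)$. Make $\hat{\mathrm E}$ a directed graph with the following arrows, for every $r\in\mathbb Z$: inside level $r$, $(0)\to(12)\to(13)$, $(13)\to(14)$, $(13)\to(23)$, $(14)\to(15)$, $(14)\to(24)$, $(23)\to(24)$, $(15)\to(25)$, $(24)\to(25)$, $(24)\to(34)$, $(25)\to(35)$, $(34)\to(35)$, $(34)\to(5)$, $(35)\to(45)$, $(35)\to(4)$, $(5)\to(4)$, $(45)\to(3)$, $(4)\to(3)$, $(3)\to(2)\to(1)$ (all with superscript $r$); and between levels, $(45)^r\to(0)^{r+1}$, $(3)^r\to(12)^{r+1}$, $(2)^r\to(13)^{r+1}$, $(1)^r\to(23)^{r+1}$. Put $\hat\alpha\le\hat\beta$ if there is a directed path (possibly of length $0$) from $\hat\alpha$ to $\hat\beta$; this is a partial order. Let $\mathrm{ht}:\hat{\mathrm E}\to\mathbb Z$ be the height (rank) function, i.e. the function with $\mathrm{ht}((0)^0)=0$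 and $\mathrm{ht}(\hat\beta)=\mathrm{ht}(\hat\alpha)+1$ for every arrow $\hat\alpha\to\hat\beta$. For a spinor $(\lambda,w_{ij},p_k)$ with coordinates indexed by $\mathrm E$ ($\lambda=\lambda^{(0)}$, $w_{ij}=\lambda^{(ij)}$, $p_k=\lambda^{(k)}$), consider the ten quadrics defining the cone of pure spinors over $\mathrm{OGr}^+(5,10)$: $$\Gamma^{i}=(-1)^{i+1}\bigl(\lambda p_i+\mathrm{Pf}_i(w)\bigr),\qquad \Gamma^{i^*}=\sum_{j=1}^5(-1)^{j+1}w_{ij}\,p_j\qquad(1\le i\le5),$$ where $w$ is extended to a skew-symmetric $5\times5$ matrix and $\mathrm{Pf}_i(w)$ is the Pfaffian of $w$ with its $i$-th row and column removed. Let $\hat\delta\le\hat\delta'$ in $\hat{\mathrm E}$. Let $A_{\hat\delta}^{\hat\delta'}$ be the quotient of the polynomial ring $\mathbb C[\lambda^{\hat\alpha}:\hat\alpha\in[\hat\delta,\hat\delta']]$ by the ideal generated by all coefficients of powers of $z$ in the ten expressions obtained from $\Gamma^{1},\dots,\Gamma^{5},\Gamma^{1^*},\dots,\Gamma^{5^*}$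 by substituting, for each coordinate $\lambda^\alpha$ $(\alpha\in\mathrm E)$, the generating function $$\lambda^\alpha(z)=\sum_{l:\ \alpha^l\in[\hat\delta,\hat\delta']}\lambda^{\alpha^l}z^l .$$ Then: (1) $\mathrm{Spec}(A_{\hat\delta}^{\hat\delta'})$ is a reduced affine scheme; (2) its Krull dimension is $\dim\mathrm{Spec}(A_{\hat\delta}^{\hat\delta'})=\mathrm{ht}(\hat\delta')-\mathrm{ht}(\hat\delta)+1$. -/

import Mathlib

/-- The set `E` of weights of the 16-dimensional half-spinor representation of `Spin(10)`:
`a0` is the weight `(0)`, `aij` is the weight `(ij)` with `i < j`, and `bk` is the weight `(k)`. -/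
inductive SpinWeight : Type
  | a0
  | a12 | a13 | a14 | a15 | a23 | a24 | a25 | a34 | a35 | a45
  | b1 | b2 | b3 | b4 | b5

/-- The index set `G = {1, …, 5, 1*, …, 5*}` of a basis of the 10-dimensional vector
representation: `v i` is `i`, and `d i` is `i*`. -/
inductive VecWeight : Type
  | v1 | v2 | v3 | v4 | v5
  | d1 | d2 | d3 | d4 | d5

open SpinWeight VecWeight in
/-- The ten quadratic functions `Γ^s = ∑ Γ^s_{αβ} x^α x^β` of a spinor
`x = (λ, w_{ij}, p_k)` with coordinates in a commutative ring `R`, that is,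
`Γ^i = ± (λ p_i + Pf_i(w))` and `Γ^{i*} = (w p)_i` with `p = (p_1, -p_2, p_3, -p_4, p_5)`
and `w` skew-symmetric. Their common zeros are the pure spinors. -/
def pureSpinorQuadric {R : Type*} [CommRing R] (x : SpinWeight → R) : VecWeight → R
  | v1 => x a0 * x b1 + x a25 * x a34 - x a24 * x a35 + x a23 * x a45
  | v2 => -(x a0 * x b2) - x a15 * x a34 + x a14 * x a35 - x a13 * x a45
  | v3 => x a0 * x b3 + x a15 * x a24 - x a14 * x a25 + x a12 * x a45
  | v4 => -(x a0 * x b4) - x a15 * x a23 + x a13 * x a25 - x a12 * x a35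
  | v5 => x a0 * x b5 + x a14 * x a23 - x a13 * x a24 + x a12 * x a34
  | d1 => -(x b2 * x a12) + x b3 * x a13 - x b4 * x a14 + x b5 * x a15
  | d2 => -(x b1 * x a12) + x b3 * x a23 - x b4 * x a24 + x b5 * x a25
  | d3 => -(x b1 * x a13) + x b2 * x a23 - x b4 * x a34 + x b5 * x a35
  | d4 => -(x b1 * x a14) + x b2 * x a24 - x b3 * x a34 + x b5 * x a45
  | d5 => -(x b1 * x a15) + x b2 * x a25 - x b3 * x a35 + x b4 * x a45

/-- The set `Ê = E × ℤ`; the element `⟨α, r⟩` is written `α^r`. -/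
@[ext] structure AffWeight : Type where
  /-- The weight `α` of `α^r`. -/
  wt : SpinWeight
  /-- The level `r` of `α^r`. -/
  lvl : ℤ

namespace AffWeight

open SpinWeight

/-- The arrows of the diagram `Ê`: twenty inside each level, and four from each level to the
next one. -/
inductive Arrow : AffWeight → AffWeight → Prop
  | a0_a12 (r : ℤ) : Arrow ⟨a0, r⟩ ⟨a12, r⟩
  | a12_a13 (r : ℤ) : Arrow ⟨a12, r⟩ ⟨a13, r⟩
  | a13_a14 (r : ℤ) : Arrow ⟨a13, r⟩ ⟨a14, r⟩
  | a13_a23 (r : ℤ) : Arrow ⟨a13, r⟩ ⟨a23, r⟩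
  | a14_a15 (r : ℤ) : Arrow ⟨a14, r⟩ ⟨a15, r⟩
  | a14_a24 (r : ℤ) : Arrow ⟨a14, r⟩ ⟨a24, r⟩
  | a23_a24 (r : ℤ) : Arrow ⟨a23, r⟩ ⟨a24, r⟩
  | a15_a25 (r : ℤ) : Arrow ⟨a15, r⟩ ⟨a25, r⟩
  | a24_a25 (r : ℤ) : Arrow ⟨a24, r⟩ ⟨a25, r⟩
  | a24_a34 (r : ℤ) : Arrow ⟨a24, r⟩ ⟨a34, r⟩
  | a25_a35 (r : ℤ) : Arrow ⟨a25, r⟩ ⟨a35, r⟩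
  | a34_a35 (r : ℤ) : Arrow ⟨a34, r⟩ ⟨a35, r⟩
  | a34_b5 (r : ℤ) : Arrow ⟨a34, r⟩ ⟨b5, r⟩
  | a35_a45 (r : ℤ) : Arrow ⟨a35, r⟩ ⟨a45, r⟩
  | a35_b4 (r : ℤ) : Arrow ⟨a35, r⟩ ⟨b4, r⟩
  | b5_b4 (r : ℤ) : Arrow ⟨b5, r⟩ ⟨b4, r⟩
  | a45_b3 (r : ℤ) : Arrow ⟨a45, r⟩ ⟨b3, r⟩
  | b4_b3 (r : ℤ) : Arrow ⟨b4, r⟩ ⟨b3, r⟩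
  | b3_b2 (r : ℤ) : Arrow ⟨b3, r⟩ ⟨b2, r⟩
  | b2_b1 (r : ℤ) : Arrow ⟨b2, r⟩ ⟨b1, r⟩
  | a45_a0 (r : ℤ) : Arrow ⟨a45, r⟩ ⟨a0, r + 1⟩
  | b3_a12 (r : ℤ) : Arrow ⟨b3, r⟩ ⟨a12, r + 1⟩
  | b2_a13 (r : ℤ) : Arrow ⟨b2, r⟩ ⟨a13, r + 1⟩
  | b1_a23 (r : ℤ) : Arrow ⟨b1, r⟩ ⟨a23, r + 1⟩

/-- The height function on `Ê`. -/
def ht : AffWeight → ℤ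
  | ⟨a0, r⟩ => 8 * r
  | ⟨a12, r⟩ => 8 * r + 1
  | ⟨a13, r⟩ => 8 * r + 2
  | ⟨a14, r⟩ => 8 * r + 3
  | ⟨a23, r⟩ => 8 * r + 3
  | ⟨a15, r⟩ => 8 * r + 4
  | ⟨a24, r⟩ => 8 * r + 4
  | ⟨a25, r⟩ => 8 * r + 5
  | ⟨a34, r⟩ => 8 * r + 5
  | ⟨a35, r⟩ => 8 * r + 6
  | ⟨b5, r⟩ => 8 * r + 6
  | ⟨a45, r⟩ => 8 * r + 7
  | ⟨b4, r⟩ => 8 * r + 7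
  | ⟨b3, r⟩ => 8 * r + 8
  | ⟨b2, r⟩ => 8 * r + 9
  | ⟨b1, r⟩ => 8 * r + 10

theorem ht_zero : ht ⟨a0, 0⟩ = 0 := rfl

/-- The defining property of the height: it grows by one along each arrow. -/
theorem Arrow.ht_eq {x y : AffWeight} (h : Arrow x y) : ht x + 1 = ht y := by
  cases h <;> simp only [ht] <;> ring

theorem ht_lt_of_transGen {x y : AffWeight} (h : Relation.TransGen Arrow x y) : ht x < ht y := by
  induction h with
  | single h => have := h.ht_eq; omega
  | tail _ h ih => have := h.ht_eq; omega

/-- The partial order on `Ê`: `x ≤ y` if there is a directed path from `x` to `y`. -/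
instance : PartialOrder AffWeight where
  le := Relation.ReflTransGen Arrow
  le_refl _ := Relation.ReflTransGen.refl
  le_trans _ _ _ := Relation.ReflTransGen.trans
  le_antisymm x y hxy hyx := by
    rcases Relation.reflTransGen_iff_eq_or_transGen.mp hxy with h | h
    · exact h.symm
    · rcases Relation.reflTransGen_iff_eq_or_transGen.mp hyx with h' | h'
      · exact h'
      · have h1 := ht_lt_of_transGen h
        have h2 := ht_lt_of_transGen h'
        omega

/-- The level is monotone, so every `α^l ∈ [x, y]` satisfies `x.lvl ≤ l ≤ y.lvl`. -/
theorem lvl_le_of_le {x y : AffWeight} (h : x ≤ y) : x.lvl ≤ y.lvl := by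
  have h' : Relation.ReflTransGen Arrow x y := h
  induction h' with
  | refl => exact le_rfl
  | @tail b c hb hbc ih =>
    refine (ih hb).trans ?_
    cases hbc <;> simp

end AffWeight

noncomputable section

open Classical LaurentPolynomial

/-- The polynomial ring `ℂ[λ^α̂]`, with one variable for each `α̂ ∈ [δ, δ']`. -/
abbrev RichardsonPoly (δ δ' : AffWeight) : Type :=
  MvPolynomial (Set.Icc δ δ') ℂ

/-- The generating function `λ^α(z) = ∑ λ^{α^l} z^l`, where the sum runs over all `l` such that
`α^l ∈ [δ, δ']`; all of these lie between the levels of `δ` and `δ'`. -/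
def richardsonGen (δ δ' : AffWeight) (α : SpinWeight) :
    LaurentPolynomial (RichardsonPoly δ δ') :=
  ∑ l ∈ Finset.Icc δ.lvl δ'.lvl,
    if h : (⟨α, l⟩ : AffWeight) ∈ Set.Icc δ δ' then
      LaurentPolynomial.C (MvPolynomial.X ⟨⟨α, l⟩, h⟩) * LaurentPolynomial.T l
    else 0

/-- The relation `Γ^{s^l}`: the coefficient of `z^l` in `∑ Γ^s_{αβ} λ^α(z) λ^β(z)`. -/
def richardsonRelation (δ δ' : AffWeight) (s : VecWeight) (l : ℤ) : RichardsonPoly δ δ' :=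
  (pureSpinorQuadric (richardsonGen δ δ') s).coeff l

/-- The ideal generated by all the relations `Γ^{s^l}`. -/
def richardsonIdeal (δ δ' : AffWeight) : Ideal (RichardsonPoly δ δ') :=
  Ideal.span {f | ∃ (s : VecWeight) (l : ℤ), f = richardsonRelation δ δ' s l}

/-- The algebra `A_δ^δ'`, whose projective spectrum is a semi-infinite Richardson variety. -/
abbrev RichardsonAlgebra (δ δ' : AffWeight) : Type :=
  RichardsonPoly δ δ' ⧸ richardsonIdeal δ δ'

end

/-! The quadrics obey a straightening law. Drawn in the plane by `left` and `right`, the poset is a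
staircase strip with the componentwise order. Each incomparable pair is a term of some relation, all
of whose other terms are more spread out in height. Hence the standard monomials, products along
chains of `[δ, δ']`, span the algebra (`span_stdMonomial_eq_top`).

They are independent as functions on an explicit family of spinors. Start with one free coordinate
at `δ` and follow a path of arrows to `δ'`. At each arrow apply the one-parameter subgroup of a node
of affine `D₅`, with a new parameter. This preserves the equations, and the lowest coefficient in
the new parameter turns a standard monomial into a nonzero multiple of one for the previous interval
(`IsSpinorParametrization.act`).

So the algebra embeds into an iterated polynomial ring of transcendence degree `ht δ' - ht δ + 1`.
It is a domain, hence reduced, and Noether normalization bounds its dimension from above.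
Conversely, for an arrow from `δ` to `ε`, the coordinate at `δ` is a nonzerodivisor killed by the
surjection onto the algebra of `[ε, δ']`, so every arrow contributes at least one to the dimension.
-/

namespace AffWeight

open SpinWeight

/-! ### Planar model of the poset. -/

/-- The first planar coordinate of an element of `Ê`. -/
def left : AffWeight → ℤ
  | ⟨a0, r⟩ => 4 * r
  | ⟨a12, r⟩ => 4 * r
  | ⟨a13, r⟩ => 4 * r
  | ⟨a14, r⟩ => 4 * r + 1
  | ⟨a15, r⟩ => 4 * r + 2
  | ⟨a23, r⟩ => 4 * r
  | ⟨a24, r⟩ => 4 * r + 1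
  | ⟨a25, r⟩ => 4 * r + 2
  | ⟨a34, r⟩ => 4 * r + 1
  | ⟨a35, r⟩ => 4 * r + 2
  | ⟨a45, r⟩ => 4 * r + 3
  | ⟨b5, r⟩ => 4 * r + 1
  | ⟨b4, r⟩ => 4 * r + 2
  | ⟨b3, r⟩ => 4 * r + 3
  | ⟨b2, r⟩ => 4 * r + 3
  | ⟨b1, r⟩ => 4 * r + 3

/-- The second planar coordinate of an element of `Ê`. -/
def right : AffWeight → ℤ
  | ⟨a0, r⟩ => 4 * r - 2
  | ⟨a12, r⟩ => 4 * r - 1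
  | ⟨a13, r⟩ => 4 * r
  | ⟨a14, r⟩ => 4 * r
  | ⟨a15, r⟩ => 4 * r
  | ⟨a23, r⟩ => 4 * r + 1
  | ⟨a24, r⟩ => 4 * r + 1
  | ⟨a25, r⟩ => 4 * r + 1
  | ⟨a34, r⟩ => 4 * r + 2
  | ⟨a35, r⟩ => 4 * r + 2
  | ⟨a45, r⟩ => 4 * r + 2
  | ⟨b5, r⟩ => 4 * r + 3
  | ⟨b4, r⟩ => 4 * r + 3
  | ⟨b3, r⟩ => 4 * r + 3
  | ⟨b2, r⟩ => 4 * r + 4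
  | ⟨b1, r⟩ => 4 * r + 5

theorem ht_eq (x : AffWeight) : ht x = left x + right x + 2 := by
  obtain ⟨a, r⟩ := x
  cases a <;> simp only [ht, left, right] <;> ring

/-- Together with `left_le`: each row of constant `right` lies in a window of four consecutive
values of `left`, and the window shifts by two at every second row. -/
theorem left_ge (x : AffWeight) : 2 * (right x / 2) - 1 ≤ left x := by
  obtain ⟨a, r⟩ := x
  cases a <;> simp only [left, right] <;> omega

theorem left_le (x : AffWeight) : left x ≤ 2 * (right x / 2) + 2 := by
  obtain ⟨a, r⟩ := x
  cases a <;> simp only [left, right] <;> omega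

theorem eq_of_left_right {x y : AffWeight} (h₁ : left x = left y) (h₂ : right x = right y) :
    x = y := by
  obtain ⟨a, r⟩ := x
  obtain ⟨b, q⟩ := y
  cases a <;> cases b <;> simp only [left, right] at h₁ h₂ <;>
    first
      | (exfalso; omega)
      | (obtain rfl : r = q := by omega
         rfl)

theorem Arrow.left_right {x y : AffWeight} (h : Arrow x y) :
    left y = left x + 1 ∧ right y = right x ∨ left y = left x ∧ right y = right x + 1 := by
  cases h <;> dsimp only [left, right] <;> omega

/-- Where two arrows leave `x`, go left if `left x < left y` and right otherwise. Where only one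
does, the other direction leaves the strip, and the strip bounds on `y` show that the remaining
arrow does not overshoot. -/
theorem exists_arrow {x y : AffWeight} (h₁ : left x ≤ left y) (h₂ : right x ≤ right y)
    (hne : ht x ≠ ht y) : ∃ z, Arrow x z ∧ left z ≤ left y ∧ right z ≤ right y := by
  have l₁ := left_ge y
  have l₂ := left_le y
  rw [ht_eq, ht_eq] at hne
  generalize left y = u at *
  generalize right y = v at *
  obtain ⟨a, r⟩ := x
  cases a <;> simp only [left, right] at h₁ h₂ hne
  · exact ⟨_, .a0_a12 r, by simp only [left, right]; omega⟩
  · exact ⟨_, .a12_a13 r, by simp only [left, right]; omega⟩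
  · by_cases h : 4 * r < u
    · exact ⟨_, .a13_a14 r, by simp only [left, right]; omega⟩
    · exact ⟨_, .a13_a23 r, by simp only [left, right]; omega⟩
  · by_cases h : 4 * r + 1 < u
    · exact ⟨_, .a14_a15 r, by simp only [left, right]; omega⟩
    · exact ⟨_, .a14_a24 r, by simp only [left, right]; omega⟩
  · exact ⟨_, .a15_a25 r, by simp only [left, right]; omega⟩
  · exact ⟨_, .a23_a24 r, by simp only [left, right]; omega⟩
  · by_cases h : 4 * r + 1 < u
    · exact ⟨_, .a24_a25 r, by simp only [left, right]; omega⟩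
    · exact ⟨_, .a24_a34 r, by simp only [left, right]; omega⟩
  · exact ⟨_, .a25_a35 r, by simp only [left, right]; omega⟩
  · by_cases h : 4 * r + 1 < u
    · exact ⟨_, .a34_a35 r, by simp only [left, right]; omega⟩
    · exact ⟨_, .a34_b5 r, by simp only [left, right]; omega⟩
  · by_cases h : 4 * r + 2 < u
    · exact ⟨_, .a35_a45 r, by simp only [left, right]; omega⟩
    · exact ⟨_, .a35_b4 r, by simp only [left, right]; omega⟩
  · by_cases h : 4 * r + 3 < u
    · exact ⟨_, .a45_a0 r, by simp only [left, right]; omega⟩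
    · exact ⟨_, .a45_b3 r, by simp only [left, right]; omega⟩
  · exact ⟨_, .b1_a23 r, by simp only [left, right]; omega⟩
  · by_cases h : 4 * r + 3 < u
    · exact ⟨_, .b2_a13 r, by simp only [left, right]; omega⟩
    · exact ⟨_, .b2_b1 r, by simp only [left, right]; omega⟩
  · by_cases h : 4 * r + 3 < u
    · exact ⟨_, .b3_a12 r, by simp only [left, right]; omega⟩
    · exact ⟨_, .b3_b2 r, by simp only [left, right]; omega⟩
  · exact ⟨_, .b4_b3 r, by simp only [left, right]; omega⟩
  · exact ⟨_, .b5_b4 r, by simp only [left, right]; omega⟩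

/-- In the planar coordinates, the order of `Ê` is the componentwise order. -/
theorem le_iff {x y : AffWeight} : x ≤ y ↔ left x ≤ left y ∧ right x ≤ right y := by
  constructor
  · intro h
    change Relation.ReflTransGen Arrow x y at h
    induction h with
    | refl => exact ⟨le_rfl, le_rfl⟩
    | tail _ h ih => have := h.left_right; omega
  · rintro ⟨h₁, h₂⟩
    generalize hn : (ht y - ht x).toNat = n
    induction n generalizing x with
    | zero =>
      rw [ht_eq, ht_eq] at hn
      exact (eq_of_left_right (by omega) (by omega)).le
    | succ n ih =>
      obtain ⟨z, hz, hz₁, hz₂⟩ := exists_arrow h₁ h₂ (by omega)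
      have := hz.ht_eq
      exact Relation.ReflTransGen.head hz (ih hz₁ hz₂ (by omega))

theorem ht_mono {x y : AffWeight} (h : x ≤ y) : ht x ≤ ht y := by
  rw [le_iff] at h
  rw [ht_eq, ht_eq]
  omega

theorem le_of_comparable {x y : AffWeight} (h : x ≤ y ∨ y ≤ x) (hxy : ht x ≤ ht y) : x ≤ y := by
  rw [le_iff, le_iff] at h
  rw [ht_eq, ht_eq] at hxy
  rw [le_iff]
  omega

end AffWeight

/-! ### Leading terms of the quadrics. -/

open SpinWeight VecWeight in
/-- The four terms of each of the ten quadrics, as triples of a sign and two weights. In the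
first two terms of a quadric, the weights are ordered by the first planar coordinate when they
become incomparable in `Ê` at suitable levels. -/
def quadricTerm : VecWeight → Fin 4 → ℤˣ × SpinWeight × SpinWeight
  | v1 => ![(1, b1, a0), (1, a34, a25), (-1, a24, a35), (1, a23, a45)]
  | v2 => ![(-1, b2, a0), (-1, a34, a15), (1, a14, a35), (-1, a13, a45)]
  | v3 => ![(1, b3, a0), (1, a24, a15), (-1, a14, a25), (1, a12, a45)]
  | v4 => ![(-1, b4, a0), (-1, a23, a15), (1, a13, a25), (-1, a12, a35)]
  | v5 => ![(1, b5, a0), (1, a23, a14), (-1, a13, a24), (1, a12, a34)]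
  | d1 => ![(-1, b2, a12), (1, b5, a15), (1, b3, a13), (-1, b4, a14)]
  | d2 => ![(-1, b1, a12), (1, b5, a25), (1, b3, a23), (-1, b4, a24)]
  | d3 => ![(-1, b1, a13), (1, b5, a35), (1, b2, a23), (-1, b4, a34)]
  | d4 => ![(-1, b1, a14), (1, b5, a45), (1, b2, a24), (-1, b3, a34)]
  | d5 => ![(-1, b1, a15), (1, b4, a45), (1, b2, a25), (-1, b3, a35)]

theorem pureSpinorQuadric_eq_sum {R : Type*} [CommRing R] (x : SpinWeight → R) (s : VecWeight) :
    pureSpinorQuadric x s = ∑ k, ((quadricTerm s k).1 : ℤ) •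
      (x (quadricTerm s k).2.1 * x (quadricTerm s k).2.2) := by
  cases s <;> simp [pureSpinorQuadric, quadricTerm, Fin.sum_univ_four] <;> ring

theorem map_pureSpinorQuadric {R S : Type*} [CommRing R] [CommRing S] (f : R →+* S)
    (x : SpinWeight → R) (s : VecWeight) :
    f (pureSpinorQuadric x s) = pureSpinorQuadric (fun α ↦ f (x α)) s := by
  simp only [pureSpinorQuadric_eq_sum, map_sum, map_zsmul, map_mul]

namespace AffWeight

open SpinWeight VecWeight

/-- The pair `γ, ε` has the same total height as `x, y`, but it is more spread out. -/
def Spread (x y γ ε : AffWeight) : Prop :=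
  ht γ + ht ε = ht x + ht y ∧ (ht γ < ht x ∧ ht γ < ht y ∨ ht ε < ht x ∧ ht ε < ht y)

/-- The strip is so narrow that `y` is at the level of `x` or at the next one. Up to shift there are
ten pairs of each kind: those at one level are the terms of index 1 of the ten quadrics, the others
the terms of index 0. -/
theorem exists_leading_quadricTerm {x y : AffWeight} (h₁ : left x < left y)
    (h₂ : right y < right x) :
    ∃ s k, (quadricTerm s k).2 = (x.wt, y.wt) ∧ ∀ k' i, ¬ (k' = k ∧ i = x.lvl) →
      Spread x y ⟨(quadricTerm s k').2.1, i⟩ ⟨(quadricTerm s k').2.2, x.lvl + y.lvl - i⟩ := by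
  obtain ⟨a, r⟩ := x
  obtain ⟨b, q⟩ := y
  cases a <;> cases b <;> dsimp only [left, right] at h₁ h₂ <;>
    first
    | (exfalso; omega)
    | (first
        | (obtain rfl : q = r := by omega
           first
           | refine ⟨v1, 1, rfl, fun k i hk ↦ ?_⟩
           | refine ⟨v2, 1, rfl, fun k i hk ↦ ?_⟩
           | refine ⟨v3, 1, rfl, fun k i hk ↦ ?_⟩
           | refine ⟨v4, 1, rfl, fun k i hk ↦ ?_⟩
           | refine ⟨v5, 1, rfl, fun k i hk ↦ ?_⟩
           | refine ⟨d1, 1, rfl, fun k i hk ↦ ?_⟩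
           | refine ⟨d2, 1, rfl, fun k i hk ↦ ?_⟩
           | refine ⟨d3, 1, rfl, fun k i hk ↦ ?_⟩
           | refine ⟨d4, 1, rfl, fun k i hk ↦ ?_⟩
           | refine ⟨d5, 1, rfl, fun k i hk ↦ ?_⟩)
        | (obtain rfl : q = r + 1 := by omega
           first
           | refine ⟨v1, 0, rfl, fun k i hk ↦ ?_⟩
           | refine ⟨v2, 0, rfl, fun k i hk ↦ ?_⟩
           | refine ⟨v3, 0, rfl, fun k i hk ↦ ?_⟩
           | refine ⟨v4, 0, rfl, fun k i hk ↦ ?_⟩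
           | refine ⟨v5, 0, rfl, fun k i hk ↦ ?_⟩
           | refine ⟨d1, 0, rfl, fun k i hk ↦ ?_⟩
           | refine ⟨d2, 0, rfl, fun k i hk ↦ ?_⟩
           | refine ⟨d3, 0, rfl, fun k i hk ↦ ?_⟩
           | refine ⟨d4, 0, rfl, fun k i hk ↦ ?_⟩
           | refine ⟨d5, 0, rfl, fun k i hk ↦ ?_⟩)
       fin_cases k <;> simp [quadricTerm, Spread, ht] at hk ⊢ <;> omega)

/-- Standard monomials on the interval `[δ, δ']`, as weakly increasing lists. -/
abbrev StdMonomial (δ δ' : AffWeight) : Type :=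
  {m : List AffWeight // m.Pairwise (· ≤ ·) ∧ ∀ x ∈ m, x ∈ Set.Icc δ δ'}

end AffWeight

theorem List.exists_perm_cons_cons_of_not_pairwise {α : Type*} {R : α → α → Prop} {l : List α}
    (h : ¬ l.Pairwise R) : ∃ a b m, l.Perm (a :: b :: m) ∧ ¬ R a b := by
  classical
  induction l with
  | nil => exact absurd List.Pairwise.nil h
  | cons a l ih =>
    rw [List.pairwise_cons, not_and_or] at h
    rcases h with h | h
    · push Not at h
      obtain ⟨b, hb, hab⟩ := h
      exact ⟨a, b, l.erase b, (List.perm_cons_erase hb).cons a, hab⟩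
    · obtain ⟨c, d, m, hp, hcd⟩ := ih h
      refine ⟨c, d, a :: m, (hp.cons a).trans ?_, hcd⟩
      exact (List.Perm.swap c a _).trans ((List.Perm.swap d a _).cons c)

/-! ### Straightening: standard monomials span. -/

section

open Classical LaurentPolynomial AffWeight

variable {δ δ' : AffWeight}

/-- The variable `λ^x` for `x ∈ [δ, δ']`, extended by zero to the rest of `Ê`. -/
noncomputable def richardsonVar (δ δ' x : AffWeight) : RichardsonPoly δ δ' :=
  if h : x ∈ Set.Icc δ δ' then MvPolynomial.X ⟨x, h⟩ else 0

theorem richardsonVar_of_mem {x : AffWeight} (h : x ∈ Set.Icc δ δ') :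
    richardsonVar δ δ' x = MvPolynomial.X ⟨x, h⟩ := dif_pos h

theorem richardsonVar_of_notMem {x : AffWeight} (h : x ∉ Set.Icc δ δ') :
    richardsonVar δ δ' x = 0 := dif_neg h

theorem richardsonGen_eq (α : SpinWeight) : richardsonGen δ δ' α =
    ∑ l ∈ Finset.Icc δ.lvl δ'.lvl, C (richardsonVar δ δ' ⟨α, l⟩) * T l := by
  refine Finset.sum_congr rfl fun l _ ↦ ?_
  unfold richardsonVar
  split_ifs <;> simp

theorem LaurentPolynomial.coeff_C_mul_T_mul {R : Type*} [CommSemiring R] (a : R) (i l : ℤ)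
    (f : R[T;T⁻¹]) : (C a * T i * f).coeff l = a * f.coeff (l - i) := by
  rw [← single_eq_C_mul_T, AddMonoidAlgebra.coeff_single_mul_apply]
  congr 2
  ring

theorem coeff_richardsonGen (α : SpinWeight) (l : ℤ) :
    (richardsonGen δ δ' α).coeff l = richardsonVar δ δ' ⟨α, l⟩ := by
  simp only [richardsonGen_eq, ← single_eq_C_mul_T, AddMonoidAlgebra.coeff_sum,
    AddMonoidAlgebra.coeff_single, Finsupp.finsetSum_apply, Finsupp.single_apply]
  rw [Finset.sum_ite_eq']
  split_ifs with h
  · rfl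
  · refine (richardsonVar_of_notMem fun hm ↦ h ?_).symm
    exact Finset.mem_Icc.mpr ⟨lvl_le_of_le hm.1, lvl_le_of_le hm.2⟩

theorem coeff_richardsonGen_mul (α β : SpinWeight) (l : ℤ) :
    (richardsonGen δ δ' α * richardsonGen δ δ' β).coeff l = ∑ i ∈ Finset.Icc δ.lvl δ'.lvl,
      richardsonVar δ δ' ⟨α, i⟩ * richardsonVar δ δ' ⟨β, l - i⟩ := by
  rw [richardsonGen_eq α, Finset.sum_mul, AddMonoidAlgebra.coeff_sum, Finsupp.finsetSum_apply]
  simp only [coeff_C_mul_T_mul, coeff_richardsonGen]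

/-- The class of `λ^x` in the Richardson algebra, extended by zero to all of `Ê`. -/
noncomputable def richardsonCoord (δ δ' x : AffWeight) : RichardsonAlgebra δ δ' :=
  Ideal.Quotient.mk _ (richardsonVar δ δ' x)

theorem richardsonCoord_of_notMem {x : AffWeight} (h : x ∉ Set.Icc δ δ') :
    richardsonCoord δ δ' x = 0 := by
  rw [richardsonCoord, richardsonVar_of_notMem h, map_zero]

theorem sum_richardsonCoord_eq_zero (s : VecWeight) (l : ℤ) :
    ∑ k, ((quadricTerm s k).1 : ℤ) • ∑ i ∈ Finset.Icc δ.lvl δ'.lvl,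
      richardsonCoord δ δ' ⟨(quadricTerm s k).2.1, i⟩ *
        richardsonCoord δ δ' ⟨(quadricTerm s k).2.2, l - i⟩ = 0 := by
  have h : Ideal.Quotient.mk (richardsonIdeal δ δ') (richardsonRelation δ δ' s l) = 0 :=
    Ideal.Quotient.eq_zero_iff_mem.mpr (Ideal.subset_span ⟨s, l, rfl⟩)
  rw [richardsonRelation, pureSpinorQuadric_eq_sum, AddMonoidAlgebra.coeff_sum,
    Finsupp.finsetSum_apply] at h
  simp only [AddMonoidAlgebra.coeff_smul_apply, coeff_richardsonGen_mul, map_sum, map_zsmul,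
    map_mul] at h
  exact h

/-- The straightening law. -/
theorem richardsonCoord_mul_mem_span {x y : AffWeight} (h : ¬ (x ≤ y ∨ y ≤ x)) :
    richardsonCoord δ δ' x * richardsonCoord δ δ' y ∈ Submodule.span ℂ
      {f | ∃ γ ε, Spread x y γ ε ∧ f = richardsonCoord δ δ' γ * richardsonCoord δ δ' ε} := by
  wlog hxy : left x < left y generalizing x y
  · have hyx : ¬ (y ≤ x ∨ x ≤ y) := by tauto
    rw [mul_comm]
    refine Submodule.span_mono ?_ (this hyx ?_)
    · rintro _ ⟨γ, ε, hs, rfl⟩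
      exact ⟨γ, ε, by unfold Spread at *; omega, rfl⟩
    · rw [le_iff, le_iff] at h
      omega
  -- Membership of `x` ensures that `x.lvl` lies in the range of summation of the relation.
  by_cases hx : x ∈ Set.Icc δ δ'
  swap
  · rw [richardsonCoord_of_notMem hx, zero_mul]
    exact zero_mem _
  obtain ⟨s, k, hk, hs⟩ := exists_leading_quadricTerm hxy (by rw [le_iff, le_iff] at h; omega)
  set W := Submodule.span ℂ
      {f | ∃ γ ε, Spread x y γ ε ∧ f = richardsonCoord δ δ' γ * richardsonCoord δ δ' ε}
  -- Modulo `W` only the leading term of the relation survives, and its coefficient is a sign.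
  have hW : ∀ k' i, ¬ (k' = k ∧ i = x.lvl) →
      W.mkQ (richardsonCoord δ δ' ⟨(quadricTerm s k').2.1, i⟩ *
        richardsonCoord δ δ' ⟨(quadricTerm s k').2.2, x.lvl + y.lvl - i⟩) = 0 := fun k' i hk' ↦
    (Submodule.Quotient.mk_eq_zero _).mpr (Submodule.subset_span ⟨_, _, hs k' i hk', rfl⟩)
  have key := congrArg W.mkQ (sum_richardsonCoord_eq_zero (δ := δ) (δ' := δ') s (x.lvl + y.lvl))
  simp only [map_sum, map_zsmul, map_zero] at key
  rw [Finset.sum_eq_single k, Finset.sum_eq_single x.lvl, hk, ← Units.smul_def] at key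
  · have key' := (smul_eq_zero_iff_eq (quadricTerm s k).1).mp key
    rw [add_sub_cancel_left] at key'
    exact (Submodule.Quotient.mk_eq_zero _).mp key'
  · exact fun i _ hi ↦ hW k i fun h ↦ hi h.2
  · exact fun hx' ↦ absurd (Finset.mem_Icc.mpr ⟨lvl_le_of_le hx.1, lvl_le_of_le hx.2⟩) hx'
  · intro k' _ hk'
    rw [Finset.sum_eq_zero fun i _ ↦ hW k' i fun h ↦ hk' h.1, smul_zero]
  · exact fun hk' ↦ absurd (Finset.mem_univ k) hk'

/-- Moving two numbers apart with fixed sum raises their sum of squares about any centre; this makes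
straightening terminate. -/
theorem AffWeight.sq_ht_lt {x y γ ε : AffWeight} (h : Spread x y γ ε) (c : ℤ) :
    (ht x - c) ^ 2 + (ht y - c) ^ 2 < (ht γ - c) ^ 2 + (ht ε - c) ^ 2 := by
  obtain ⟨h₁, h₂ | h₂⟩ := h
  · have : 0 < (ht x - ht γ) * (ht y - ht γ) := mul_pos (by omega) (by omega)
    rw [show ht ε = ht x + ht y - ht γ by omega]
    linarith
  · have : 0 < (ht x - ht ε) * (ht y - ht ε) := mul_pos (by omega) (by omega)
    rw [show ht γ = ht x + ht y - ht ε by omega]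
    linarith

theorem AffWeight.exists_perm_pairwise_le {l : List AffWeight}
    (h : l.Pairwise fun x y ↦ x ≤ y ∨ y ≤ x) :
    ∃ m : List AffWeight, m.Perm l ∧ m.Pairwise (· ≤ ·) := by
  refine ⟨l.insertionSort fun x y ↦ ht x ≤ ht y, List.perm_insertionSort _ l, ?_⟩
  have h₁ : (l.insertionSort fun x y ↦ ht x ≤ ht y).Pairwise fun x y ↦ ht x ≤ ht y := by
    have : Std.Total fun x y : AffWeight ↦ ht x ≤ ht y := ⟨fun x y ↦ le_total _ _⟩
    have : IsTrans AffWeight fun x y ↦ ht x ≤ ht y := ⟨fun x y z ↦ le_trans⟩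
    exact List.pairwise_insertionSort _ l
  have h₂ := (List.perm_insertionSort (fun x y ↦ ht x ≤ ht y) l).symm.pairwise h fun h ↦ h.symm
  exact h₁.imp₂ (fun x y h h' ↦ le_of_comparable h' h) h₂

theorem prod_richardsonCoord_mem_span (l : List AffWeight) :
    (l.map (richardsonCoord δ δ')).prod ∈ Submodule.span ℂ
      (Set.range fun m : StdMonomial δ δ' ↦ (m.1.map (richardsonCoord δ δ')).prod) := by
  set D := ht δ' - ht δ
  -- Each summand is nonnegative on `[δ, δ']`, and straightening an incomparable pair strictly
  -- lowers the sum. Monomials with a factor outside the interval are zero, so `toNat` loses nothing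
  -- that matters.
  generalize hn : (l.map fun x ↦ D ^ 2 - (ht x - ht δ) ^ 2).sum.toNat = n
  induction n using Nat.strong_induction_on generalizing l with
  | _ n ih =>
  by_cases hl : ∀ x ∈ l, x ∈ Set.Icc δ δ'
  swap
  · push Not at hl
    obtain ⟨x, hx, hx'⟩ := hl
    rw [List.prod_eq_zero]
    · exact zero_mem _
    · exact List.mem_map.mpr ⟨x, hx, richardsonCoord_of_notMem hx'⟩
  by_cases hc : l.Pairwise fun x y ↦ x ≤ y ∨ y ≤ x
  · obtain ⟨m, hm, hm'⟩ := exists_perm_pairwise_le hc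
    rw [← (hm.map _).prod_eq]
    exact Submodule.subset_span ⟨⟨m, hm', fun x hx ↦ hl x (hm.mem_iff.mp hx)⟩, rfl⟩
  obtain ⟨x, y, m, hp, hxy⟩ := List.exists_perm_cons_cons_of_not_pairwise hc
  have hD : ∀ x ∈ Set.Icc δ δ', 0 ≤ D ^ 2 - (ht x - ht δ) ^ 2 := by
    intro x hx
    have h₁ := ht_mono hx.1
    have h₂ := ht_mono hx.2
    nlinarith
  rw [(hp.map _).prod_eq, List.map_cons, List.map_cons, List.prod_cons, List.prod_cons, ← mul_assoc]
  rw [(hp.map _).sum_eq, List.map_cons, List.map_cons, List.sum_cons, List.sum_cons] at hn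
  have hl' : ∀ z ∈ m, z ∈ Set.Icc δ δ' := fun z hz ↦ hl z (hp.mem_iff.mpr (by simp [hz]))
  have hm : 0 ≤ (m.map fun x ↦ D ^ 2 - (ht x - ht δ) ^ 2).sum := by
    refine List.sum_nonneg fun z hz ↦ ?_
    obtain ⟨w, hw, rfl⟩ := List.mem_map.mp hz
    exact hD w (hl' w hw)
  refine Submodule.span_induction (p := fun f _ ↦ f * (m.map (richardsonCoord δ δ')).prod ∈
    Submodule.span ℂ (Set.range fun m : StdMonomial δ δ' ↦
      (m.1.map (richardsonCoord δ δ')).prod)) ?_ ?_ ?_ ?_ (richardsonCoord_mul_mem_span hxy)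
  · rintro _ ⟨γ, ε, hs, rfl⟩
    by_cases hγ : γ ∈ Set.Icc δ δ'
    swap
    · simp [richardsonCoord_of_notMem hγ]
    by_cases hε : ε ∈ Set.Icc δ δ'
    swap
    · simp [richardsonCoord_of_notMem hε]
    rw [mul_assoc, ← List.prod_cons, ← List.map_cons, ← List.prod_cons, ← List.map_cons]
    refine ih _ ?_ (γ :: ε :: m) rfl
    rw [List.map_cons, List.map_cons, List.sum_cons, List.sum_cons, ← hn]
    have h₁ := sq_ht_lt hs (ht δ)
    have h₂ := hD γ hγ
    have h₃ := hD ε hε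
    omega
  · simp
  · intro f g _ _ hf hg
    rw [add_mul]
    exact add_mem hf hg
  · intro c f _ hf
    rw [smul_mul_assoc]
    exact Submodule.smul_mem _ c hf

/-- The standard monomials span the Richardson algebra. -/
theorem span_stdMonomial_eq_top : Submodule.span ℂ
    (Set.range fun m : StdMonomial δ δ' ↦ (m.1.map (richardsonCoord δ δ')).prod) = ⊤ := by
  set S := Submodule.span ℂ
    (Set.range fun l : List AffWeight ↦ (l.map (richardsonCoord δ δ')).prod)
  have hS : S ≤ Submodule.span ℂ
      (Set.range fun m : StdMonomial δ δ' ↦ (m.1.map (richardsonCoord δ δ')).prod) := by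
    rw [Submodule.span_le]
    rintro _ ⟨l, rfl⟩
    exact prod_richardsonCoord_mem_span l
  refine eq_top_iff.mpr (le_trans ?_ hS)
  rintro f -
  obtain ⟨p, rfl⟩ := Ideal.Quotient.mk_surjective f
  induction p using MvPolynomial.induction_on with
  | C c =>
    have : Ideal.Quotient.mk (richardsonIdeal δ δ') (MvPolynomial.C c) =
        c • (([] : List AffWeight).map (richardsonCoord δ δ')).prod := by
      rw [List.map_nil, List.prod_nil, ← Algebra.algebraMap_eq_smul_one]
      rfl
    rw [this]
    exact Submodule.smul_mem _ c (Submodule.subset_span ⟨[], rfl⟩)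
  | add p q hp hq =>
    rw [map_add]
    exact add_mem hp hq
  | mul_X p i hp =>
    rw [map_mul]
    have hi : Ideal.Quotient.mk (richardsonIdeal δ δ') (MvPolynomial.X i) =
        richardsonCoord δ δ' i := by
      rw [richardsonCoord, richardsonVar_of_mem i.2]
    rw [hi]
    refine Submodule.span_induction (p := fun f _ ↦ f * richardsonCoord δ δ' i ∈ S) ?_ ?_ ?_ ?_ hp
    · rintro _ ⟨l, rfl⟩
      exact Submodule.subset_span ⟨i.1 :: l, by simp [mul_comm]⟩
    · simp
    · intro f g _ _ hf hg
      rw [add_mul]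
      exact add_mem hf hg
    · intro c f _ hf
      rw [smul_mul_assoc]
      exact Submodule.smul_mem _ c hf

end

/-! ### One-parameter subgroups of affine `D₅` and their arrows. -/

/-- The nodes of the affine Dynkin diagram of type `D₅`: `nij` exchanges the indices `i` and `j`,
`plus` joins `(0)` to `(12)`, and `zero` is the affine node. -/
inductive AffineNode : Type
  | n12 | n23 | n34 | n45 | plus | zero

namespace AffineNode

open SpinWeight VecWeight

/-- The action of the Chevalley generator of a node on spinors over `R[z]`: its component of
weight `α` is `c z ^ n` times the component of weight `β`, where the value is `(c, β, n)`. -/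
def chevalley : AffineNode → SpinWeight → ℤ × SpinWeight × ℤ
  | n12, a23 => (1, a13, 0)
  | n12, a24 => (1, a14, 0)
  | n12, a25 => (1, a15, 0)
  | n12, b1 => (1, b2, 0)
  | n23, a13 => (1, a12, 0)
  | n23, a34 => (1, a24, 0)
  | n23, a35 => (1, a25, 0)
  | n23, b2 => (1, b3, 0)
  | n34, a14 => (1, a13, 0)
  | n34, a24 => (1, a23, 0)
  | n34, a45 => (1, a35, 0)
  | n34, b3 => (1, b4, 0)
  | n45, a15 => (1, a14, 0)
  | n45, a25 => (1, a24, 0)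
  | n45, a35 => (1, a34, 0)
  | n45, b4 => (1, b5, 0)
  | plus, a12 => (1, a0, 0)
  | plus, b5 => (-1, a34, 0)
  | plus, b4 => (-1, a35, 0)
  | plus, b3 => (-1, a45, 0)
  | zero, a0 => (1, a45, 1)
  | zero, a12 => (-1, b3, 1)
  | zero, a13 => (-1, b2, 1)
  | zero, a23 => (-1, b1, 1)
  | _, α => (0, α, 0)

/-- The coefficient of the Chevalley generator of `i` at the component `x`. -/
def sgn (i : AffineNode) (x : AffWeight) : ℤ := (i.chevalley x.wt).1

/-- The source of the arrow labelled `i` with target `x`, if there is one. -/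
def pre (i : AffineNode) (x : AffWeight) : AffWeight :=
  ⟨(i.chevalley x.wt).2.1, x.lvl - (i.chevalley x.wt).2.2⟩

theorem exists_of_arrow {x y : AffWeight} (h : AffWeight.Arrow x y) :
    ∃ i : AffineNode, i.sgn y ≠ 0 ∧ i.pre y = x := by
  cases h with
  | a13_a23 r | a14_a24 r | a15_a25 r | b2_b1 r =>
    exact ⟨n12, by simp [sgn, chevalley], by simp [pre, chevalley]⟩
  | a12_a13 r | a24_a34 r | a25_a35 r | b3_b2 r =>
    exact ⟨n23, by simp [sgn, chevalley], by simp [pre, chevalley]⟩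
  | a13_a14 r | a23_a24 r | a35_a45 r | b4_b3 r =>
    exact ⟨n34, by simp [sgn, chevalley], by simp [pre, chevalley]⟩
  | a14_a15 r | a24_a25 r | a34_a35 r | b5_b4 r =>
    exact ⟨n45, by simp [sgn, chevalley], by simp [pre, chevalley]⟩
  | a0_a12 r | a34_b5 r | a35_b4 r | a45_b3 r =>
    exact ⟨plus, by simp [sgn, chevalley], by simp [pre, chevalley]⟩
  | a45_a0 r | b3_a12 r | b2_a13 r | b1_a23 r =>
    exact ⟨zero, by simp [sgn, chevalley], by simp [pre, chevalley]⟩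

open AffWeight

/-- The arrows of a given label either all increase the first planar coordinate or all increase
the second one, and the targets of these arrows are determined by a congruence. -/
theorem arrow_direction (i : AffineNode) :
    (∃ m c : ℤ, ∀ x, i.sgn x ≠ 0 ↔ left x % m = c ∧ 2 * (right x / 2) ≤ left x) ∧
        (∀ x, i.sgn x ≠ 0 → left x = left (i.pre x) + 1 ∧ right x = right (i.pre x)) ∨
    (∃ m c : ℤ, ∀ x, i.sgn x ≠ 0 ↔ right x % m = c ∧ left x ≤ 2 * ((right x - 1) / 2) + 2) ∧
        (∀ x, i.sgn x ≠ 0 → left x = left (i.pre x) ∧ right x = right (i.pre x) + 1) := by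
  cases i
  · refine .inr ⟨⟨4, 1, ?_⟩, ?_⟩ <;> rintro ⟨a, r⟩ <;> cases a <;>
      simp [sgn, pre, chevalley, left, right] <;> omega
  · refine .inr ⟨⟨2, 0, ?_⟩, ?_⟩ <;> rintro ⟨a, r⟩ <;> cases a <;>
      simp [sgn, pre, chevalley, left, right] <;> omega
  · refine .inl ⟨⟨2, 1, ?_⟩, ?_⟩ <;> rintro ⟨a, r⟩ <;> cases a <;>
      simp [sgn, pre, chevalley, left, right] <;> omega
  · refine .inl ⟨⟨4, 2, ?_⟩, ?_⟩ <;> rintro ⟨a, r⟩ <;> cases a <;>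
      simp [sgn, pre, chevalley, left, right] <;> omega
  · refine .inr ⟨⟨4, 3, ?_⟩, ?_⟩ <;> rintro ⟨a, r⟩ <;> cases a <;>
      simp [sgn, pre, chevalley, left, right] <;> omega
  · refine .inl ⟨⟨4, 0, ?_⟩, ?_⟩ <;> rintro ⟨a, r⟩ <;> cases a <;>
      simp [sgn, pre, chevalley, left, right] <;> omega

section Lattice

variable {i : AffineNode} {y : AffWeight}

theorem le_of_pre_le (hy : i.sgn y ≠ 0) {x : AffWeight} (hx : i.sgn x ≠ 0)
    (h : i.pre x ≤ i.pre y) : x ≤ y := by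
  rw [le_iff] at h ⊢
  rcases i.arrow_direction with ⟨-, hd⟩ | ⟨-, hd⟩ <;>
    have h₁ := hd x hx <;> have h₂ := hd y hy <;> omega

theorem pre_le (hy : i.sgn y ≠ 0) : i.pre y ≤ y := by
  rw [le_iff]
  rcases i.arrow_direction with ⟨-, hd⟩ | ⟨-, hd⟩ <;> have h₂ := hd y hy <;> omega

/-- Such an `x` lies on the same line as `y`, transverse to the direction of the arrow. The
congruence then holds for `x`, and the inequality in `arrow_direction` passes to smaller elements of
that line. -/
theorem sgn_ne_zero_of_not_le (hy : i.sgn y ≠ 0) {x : AffWeight} (hxy : x ≤ y)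
    (h : ¬ x ≤ i.pre y) : i.sgn x ≠ 0 := by
  rw [le_iff] at h hxy
  rcases i.arrow_direction with ⟨⟨m, c, hc⟩, hd⟩ | ⟨⟨m, c, hc⟩, hd⟩
  · have h₂ := hd y hy
    have h₃ : left x = left y := by omega
    have h₄ := (hc y).mp hy
    refine (hc x).mpr ⟨h₃ ▸ h₄.1, by omega⟩
  · have h₂ := hd y hy
    have h₃ : right x = right y := by omega
    have h₄ := (hc y).mp hy
    refine (hc x).mpr ⟨h₃ ▸ h₄.1, by omega⟩

theorem le_pre (hy : i.sgn y ≠ 0) {z x : AffWeight} (hxy : x ≤ y) (h : ¬ x ≤ i.pre y)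
    (hz : z ≤ i.pre y) (hzx : z ≤ x) : z ≤ i.pre x := by
  have hx := sgn_ne_zero_of_not_le hy hxy h
  rw [le_iff] at *
  rcases i.arrow_direction with ⟨-, hd⟩ | ⟨-, hd⟩ <;>
    have h₁ := hd x hx <;> have h₂ := hd y hy <;> omega

theorem pre_le_pre {z x : AffWeight} (hz : i.sgn z ≠ 0) (hx : i.sgn x ≠ 0) (hzx : z ≤ x) :
    i.pre z ≤ i.pre x := by
  rw [le_iff] at *
  rcases i.arrow_direction with ⟨-, hd⟩ | ⟨-, hd⟩ <;>
    have h₁ := hd x hx <;> have h₂ := hd z hz <;> omega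

theorem eq_of_pre_eq {z x : AffWeight} (hz : i.sgn z ≠ 0) (hx : i.sgn x ≠ 0)
    (h : i.pre z = i.pre x) : z = x :=
  le_antisymm (le_of_pre_le hx hz h.le) (le_of_pre_le hz hx h.ge)

end Lattice

section Action

open LaurentPolynomial

variable {R : Type*} [CommRing R]

/-- The one-parameter subgroup of a node, acting on spinors over `R[z, z⁻¹]`. -/
noncomputable def act (i : AffineNode) (t : R) (g : SpinWeight → R[T;T⁻¹]) (α : SpinWeight) :
    R[T;T⁻¹] :=
  g α + C ((i.chevalley α).1 * t) * T (i.chevalley α).2.2 * g (i.chevalley α).2.1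

theorem coeff_act (i : AffineNode) (t : R) (g : SpinWeight → R[T;T⁻¹]) (x : AffWeight) :
    (i.act t g x.wt).coeff x.lvl = (g x.wt).coeff x.lvl +
      i.sgn x * t * (g (i.pre x).wt).coeff (i.pre x).lvl := by
  rw [act, AddMonoidAlgebra.coeff_add, Finsupp.add_apply, coeff_C_mul_T_mul]
  rfl

/-- The quadrics transform as the vector representation: each node changes just two of them, by a
multiple of another quadric. -/
theorem pureSpinorQuadric_act (i : AffineNode) (t : R) {g : SpinWeight → R[T;T⁻¹]}
    (h : ∀ s, pureSpinorQuadric g s = 0) (s : VecWeight) :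
    pureSpinorQuadric (i.act t g) s = 0 := by
  have e₁ := h v1
  have e₂ := h v2
  have e₃ := h v3
  have e₄ := h v4
  have e₅ := h v5
  have f₁ := h d1
  have f₂ := h d2
  have f₃ := h d3
  have f₄ := h d4
  have f₅ := h d5
  simp only [pureSpinorQuadric] at e₁ e₂ e₃ e₄ e₅ f₁ f₂ f₃ f₄ f₅
  cases i <;> simp only [act, chevalley, pureSpinorQuadric, Int.cast_zero, Int.cast_one,
    Int.cast_neg, zero_mul, one_mul, neg_mul, map_zero, map_neg, add_zero, T_zero, mul_one]
  · cases s
    · linear_combination e₁ - C t * e₂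
    · linear_combination e₂
    · linear_combination e₃
    · linear_combination e₄
    · linear_combination e₅
    · linear_combination f₁
    · linear_combination f₂ + C t * f₁
    · linear_combination f₃
    · linear_combination f₄
    · linear_combination f₅
  · cases s
    · linear_combination e₁
    · linear_combination e₂ - C t * e₃
    · linear_combination e₃
    · linear_combination e₄
    · linear_combination e₅
    · linear_combination f₁
    · linear_combination f₂
    · linear_combination f₃ + C t * f₂
    · linear_combination f₄
    · linear_combination f₅
  · cases s
    · linear_combination e₁
    · linear_combination e₂
    · linear_combination e₃ - C t * e₄
    · linear_combination e₄
    · linear_combination e₅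
    · linear_combination f₁
    · linear_combination f₂
    · linear_combination f₃
    · linear_combination f₄ + C t * f₃
    · linear_combination f₅
  · cases s
    · linear_combination e₁
    · linear_combination e₂
    · linear_combination e₃
    · linear_combination e₄ - C t * e₅
    · linear_combination e₅
    · linear_combination f₁
    · linear_combination f₂
    · linear_combination f₃
    · linear_combination f₄
    · linear_combination f₅ + C t * f₄
  · cases s
    · linear_combination e₁
    · linear_combination e₂
    · linear_combination e₃
    · linear_combination e₄
    · linear_combination e₅
    · linear_combination f₁ + C t * e₂
    · linear_combination f₂ - C t * e₁
    · linear_combination f₃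
    · linear_combination f₄
    · linear_combination f₅
  · cases s
    · linear_combination e₁
    · linear_combination e₂
    · linear_combination e₃
    · linear_combination e₄ - C t * T 1 * f₅
    · linear_combination e₅ + C t * T 1 * f₄
    · linear_combination f₁
    · linear_combination f₂
    · linear_combination f₃
    · linear_combination f₄
    · linear_combination f₅

end Action

end AffineNode

/-! ### Linear independence of standard monomials. -/

open Polynomial in
-- In the coefficient of `X ^ n` of a relation, terms with `k < n` vanish by induction and terms
-- with `k > n` do not contribute.
theorem linearIndependent_of_X_pow_mul {K B ι : Type*} [Field K] [CommRing B] [Algebra K B]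
    {F : ι → B[X]} {P : ι → B[X]} {k : ι → ℕ} (hF : ∀ m, F m = X ^ k m * P m)
    (h : ∀ n, LinearIndependent K fun m : {m // k m = n} ↦ (P m).coeff 0) :
    LinearIndependent K F := by
  classical
  rw [linearIndependent_iff']
  intro s c hc m hm
  generalize hn : k m = n
  induction n using Nat.strong_induction_on generalizing m with
  | _ n ih =>
  have hcoeff := congrArg (fun p ↦ p.coeff n) hc
  simp only [finsetSum_coeff, coeff_smul, coeff_zero, hF, coeff_X_pow_mul'] at hcoeff
  have hsum : ∑ j ∈ s.subtype (fun m ↦ k m = n), c j • (P j).coeff 0 = 0 := by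
    rw [← hcoeff, Finset.sum_subtype_eq_sum_filter (f := fun j ↦ c j • (P j).coeff 0),
      Finset.sum_filter]
    refine Finset.sum_congr rfl fun j hj ↦ ?_
    rcases lt_trichotomy (k j) n with hlt | heq | hgt
    · rw [if_neg hlt.ne, ih _ hlt j hj rfl, zero_smul]
    · rw [if_pos heq, if_pos heq.le, heq, Nat.sub_self]
    · rw [if_neg hgt.ne', if_neg hgt.not_ge, smul_zero]
  exact linearIndependent_iff'.mp (h n) _ _ hsum ⟨m, hn⟩ (by simpa using hm)

/-- As `p` passes upwards, the entries satisfying it form a final segment of a sorted list, of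
length `countP`. So corresponding entries agree on `p`, and `f` separates entries that agree on `p`.
-/
theorem List.eq_of_map_eq_of_countP_eq {α β : Type*} [LE α] {p : α → Prop} [DecidablePred p]
    {f : α → β} {l l' : List α} (hl : l.Pairwise (· ≤ ·)) (hl' : l'.Pairwise (· ≤ ·))
    (hp : ∀ a ∈ l, ∀ b ∈ l, a ≤ b → p a → p b) (hp' : ∀ a ∈ l', ∀ b ∈ l', a ≤ b → p a → p b)
    (hf : ∀ a ∈ l, ∀ b ∈ l', (p a ↔ p b) → f a = f b → a = b)
    (h : l.map f = l'.map f) (hk : l.countP p = l'.countP p) : l = l' := by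
  induction l generalizing l' with
  | nil => exact (List.map_eq_nil_iff.mp h.symm).symm
  | cons a l ih =>
    cases l' with
    | nil => simp at h
    | cons a' l' =>
      have all : ∀ {b : α} {m : List α}, (b :: m).Pairwise (· ≤ ·) →
          (∀ x ∈ b :: m, ∀ y ∈ b :: m, x ≤ y → p x → p y) → p b → m.countP p = m.length := by
        intro b m hm hpm hb
        rw [List.countP_eq_length]
        intro x hx
        rw [List.pairwise_cons] at hm
        simpa using hpm b (by simp) x (by simp [hx]) (hm.1 x hx) hb
      rw [List.map_cons, List.map_cons, List.cons.injEq] at h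
      have hlen : l.length = l'.length := by simpa using congrArg List.length h.2
      have key : p a ↔ p a' := by
        constructor
        · intro ha
          by_contra ha'
          rw [List.countP_cons_of_pos (by simpa), List.countP_cons_of_neg (by simpa),
            all hl hp ha] at hk
          have := List.countP_le_length (p := (p ·)) (l := l')
          omega
        · intro ha'
          by_contra ha
          rw [List.countP_cons_of_neg (by simpa), List.countP_cons_of_pos (by simpa),
            all hl' hp' ha'] at hk
          have := List.countP_le_length (p := (p ·)) (l := l)
          omega
      have hhead : a = a' := hf a (by simp) a' (by simp) key h.1
      subst hhead
      rw [List.pairwise_cons] at hl hl'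
      congr 1
      refine ih hl.2 hl'.2 ?_ ?_ ?_ h.2 ?_
      · exact fun x hx y hy ↦ hp x (by simp [hx]) y (by simp [hy])
      · exact fun x hx y hy ↦ hp' x (by simp [hx]) y (by simp [hy])
      · exact fun x hx y hy ↦ hf x (by simp [hx]) y (by simp [hy])
      · rw [List.countP_cons, List.countP_cons] at hk
        omega

section

open AffWeight LaurentPolynomial

/-- A family `g` of Laurent polynomials over `B` that satisfies the equations of the cone of pure
spinors, whose coefficients are supported on `[δ, δ']`, and on which the standard monomials take
linearly independent values. -/
structure IsSpinorParametrization (δ δ' : AffWeight) {B : Type*} [CommRing B] [Algebra ℂ B]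
    (g : SpinWeight → B[T;T⁻¹]) : Prop where
  quadric : ∀ s, pureSpinorQuadric g s = 0
  support : ∀ x ∉ Set.Icc δ δ', (g x.wt).coeff x.lvl = 0
  linearIndependent : LinearIndependent ℂ fun m : StdMonomial δ δ' ↦
    (m.1.map fun x ↦ (g x.wt).coeff x.lvl).prod

open Classical in
theorem isSpinorParametrization_self (δ : AffWeight) :
    IsSpinorParametrization δ δ (B := Polynomial ℂ)
      fun α ↦ if α = δ.wt then C Polynomial.X * T δ.lvl else 0 where
  quadric s := by
    obtain ⟨a, r⟩ := δ
    -- No quadric contains a square, so every term has a zero factor.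
    cases s <;> cases a <;> simp [pureSpinorQuadric]
  support x hx := by
    rw [Set.Icc_self, Set.mem_singleton_iff] at hx
    split_ifs with h
    · rw [← single_eq_C_mul_T, AddMonoidAlgebra.coeff_single, Finsupp.single_apply, if_neg]
      exact fun h' ↦ hx (AffWeight.ext h h'.symm)
    · simp
  linearIndependent := by
    have hδ (m : StdMonomial δ δ) : m.1 = List.replicate m.1.length δ :=
      List.eq_replicate_iff.mpr ⟨rfl, fun x hx ↦ by simpa using m.2.2 x hx⟩
    refine linearIndependent_of_X_pow_mul (P := fun _ ↦ 1) (k := fun m ↦ m.1.length) ?_ ?_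
    · intro m
      conv_lhs => rw [hδ m]
      rw [List.map_replicate, List.prod_replicate, if_pos rfl, ← single_eq_C_mul_T,
        AddMonoidAlgebra.coeff_single, Finsupp.single_eq_same, mul_one]
    · intro n
      have : Subsingleton {m : StdMonomial δ δ // m.1.length = n} := by
        refine ⟨fun m m' ↦ Subtype.ext (Subtype.ext ?_)⟩
        rw [hδ m.1, hδ m'.1, m.2, m'.2]
      rcases isEmpty_or_nonempty {m : StdMonomial δ δ // m.1.length = n} with _ | ⟨⟨m⟩⟩
      · exact linearIndependent_empty_type
      · exact .of_subsingleton m (by simp)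

open Classical in
-- A new element `x`, not below `i.pre δ'`, has coordinate `± X` times the old coordinate of `i.pre
-- x`; any other `x` keeps its old coordinate as constant term. A standard monomial with `k` new
-- entries is thus divisible by `X ^ k`, and its coefficient there is, up to sign, the monomial
-- obtained by applying `low` to each entry. The map `low` preserves chains and, for fixed `k`, is
-- injective on them.
theorem IsSpinorParametrization.act {δ δ' : AffWeight} {i : AffineNode} (hi : i.sgn δ' ≠ 0)
    (hδ : δ ≤ i.pre δ') {B : Type*} [CommRing B] [Algebra ℂ B] {g : SpinWeight → B[T;T⁻¹]}
    (hg : IsSpinorParametrization δ (i.pre δ') g) :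
    IsSpinorParametrization δ δ' (i.act (Polynomial.X : Polynomial B)
      fun α ↦ AddMonoidAlgebra.mapRingHom ℤ Polynomial.C (g α)) := by
  have hcoeff (x : AffWeight) : (i.act (Polynomial.X : Polynomial B)
      (fun α ↦ AddMonoidAlgebra.mapRingHom ℤ Polynomial.C (g α)) x.wt).coeff x.lvl =
      Polynomial.C ((g x.wt).coeff x.lvl) + (i.sgn x : Polynomial B) * Polynomial.X *
        Polynomial.C ((g (i.pre x).wt).coeff (i.pre x).lvl) := by
    rw [AffineNode.coeff_act]
    simp
  refine ⟨fun s ↦ i.pureSpinorQuadric_act _ (fun s ↦ ?_) s, fun x hx ↦ ?_, ?_⟩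
  · rw [← map_pureSpinorQuadric, hg.quadric, map_zero]
  · rw [hcoeff, hg.support, map_zero, zero_add]
    · by_cases hs : i.sgn x = 0
      · simp [hs]
      · rw [hg.support, map_zero, mul_zero]
        intro hp
        refine hx ⟨hp.1.trans (AffineNode.pre_le hs), AffineNode.le_of_pre_le hi hs hp.2⟩
    · exact fun h ↦ hx ⟨h.1, h.2.trans (AffineNode.pre_le hi)⟩
  · set y : AffWeight → B := fun x ↦ (g x.wt).coeff x.lvl
    set q : AffWeight → Prop := fun x ↦ ¬ x ≤ i.pre δ'
    let low : AffWeight → AffWeight := fun x ↦ if q x then i.pre x else x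
    let sign : AffWeight → ℂ := fun x ↦ if q x then i.sgn x else 1
    let P : AffWeight → Polynomial B := fun x ↦
      if q x then (i.sgn x : Polynomial B) * Polynomial.C (y (i.pre x)) else
        Polynomial.C (y x) + (i.sgn x : Polynomial B) * Polynomial.X * Polynomial.C (y (i.pre x))
    have hq {x : AffWeight} (hx : x ∈ Set.Icc δ δ') (hqx : q x) : i.sgn x ≠ 0 :=
      AffineNode.sgn_ne_zero_of_not_le hi hx.2 hqx
    have hlow {x : AffWeight} (hx : x ∈ Set.Icc δ δ') : low x ∈ Set.Icc δ (i.pre δ') := by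
      by_cases hqx : q x
      · rw [show low x = i.pre x from if_pos hqx]
        exact ⟨AffineNode.le_pre hi hx.2 hqx hδ hx.1, AffineNode.pre_le_pre (hq hx hqx) hi hx.2⟩
      · rw [show low x = x from if_neg hqx]
        exact ⟨hx.1, not_not.mp hqx⟩
    have hmono {z x : AffWeight} (hz : z ∈ Set.Icc δ δ') (hx : x ∈ Set.Icc δ δ') (hzx : z ≤ x) :
        low z ≤ low x := by
      by_cases hqx : q x
      · rw [show low x = i.pre x from if_pos hqx]
        by_cases hqz : q z
        · rw [show low z = i.pre z from if_pos hqz]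
          exact AffineNode.pre_le_pre (hq hz hqz) (hq hx hqx) hzx
        · rw [show low z = z from if_neg hqz]
          exact AffineNode.le_pre hi hx.2 hqx (not_not.mp hqz) hzx
      · have hqz : ¬ q z := fun h ↦ h (hzx.trans (not_not.mp hqx))
        rwa [show low x = x from if_neg hqx, show low z = z from if_neg hqz]
    refine linearIndependent_of_X_pow_mul (P := fun m ↦ (m.1.map P).prod)
      (k := fun m ↦ m.1.countP q) (fun m ↦ ?_) fun n ↦ ?_
    · obtain ⟨l, hp, hl⟩ := m
      dsimp only
      induction l with
      | nil => simp
      | cons x l ih =>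
        rw [List.map_cons, List.map_cons, List.prod_cons, List.prod_cons,
          ih hp.of_cons fun z hz ↦ hl z (by simp [hz]), hcoeff]
        by_cases hqx : q x
        · have h₀ : (g x.wt).coeff x.lvl = 0 := hg.support x fun h ↦ hqx h.2
          rw [List.countP_cons_of_pos (by simpa), show P x = _ from if_pos hqx, h₀, map_zero]
          ring
        · rw [List.countP_cons_of_neg (by simpa), show P x = _ from if_neg hqx]
          ring
    · let ψ : {m : StdMonomial δ δ' // m.1.countP q = n} → StdMonomial δ (i.pre δ') := fun m ↦
        ⟨m.1.1.map low, by
          rw [List.pairwise_map]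
          exact m.1.2.1.imp_of_mem fun {a b} ha hb hab ↦ hmono (m.1.2.2 a ha) (m.1.2.2 b hb) hab, by
          intro x hx
          obtain ⟨z, hz, rfl⟩ := List.mem_map.mp hx
          exact hlow (m.1.2.2 z hz)⟩
      have hψ : Function.Injective ψ := by
        rintro ⟨⟨l, hl, hlI⟩, hk⟩ ⟨⟨l', hl', hlI'⟩, hk'⟩ h
        have h' : l.map low = l'.map low := congrArg Subtype.val h
        congr 2
        refine List.eq_of_map_eq_of_countP_eq (p := q) hl hl' ?_ ?_ ?_ h' (hk.trans hk'.symm)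
        · exact fun a _ b _ hab ha hb ↦ ha (hab.trans hb)
        · exact fun a _ b _ hab ha hb ↦ ha (hab.trans hb)
        · intro a ha b hb hab hlab
          by_cases hqa : q a
          · rw [show low a = i.pre a from if_pos hqa,
              show low b = i.pre b from if_pos (hab.mp hqa)] at hlab
            exact AffineNode.eq_of_pre_eq (hq (hlI a ha) hqa) (hq (hlI' b hb) (hab.mp hqa)) hlab
          · rwa [show low a = a from if_neg hqa,
              show low b = b from if_neg (mt hab.mpr hqa)] at hlab
      have hsign (l : List AffWeight) (hl : ∀ x ∈ l, x ∈ Set.Icc δ δ') :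
          (l.map sign).prod ≠ 0 := by
        refine List.prod_ne_zero fun h ↦ ?_
        obtain ⟨x, hx, hx0⟩ := List.mem_map.mp h
        by_cases hqx : q x
        · rw [show sign x = _ from if_pos hqx, Int.cast_eq_zero] at hx0
          exact hq (hl x hx) hqx hx0
        · rw [show sign x = _ from if_neg hqx] at hx0
          exact one_ne_zero hx0
      have hP (l : List AffWeight) : (l.map P).prod.coeff 0 =
          (l.map sign).prod • ((l.map low).map y).prod := by
        induction l with
        | nil => simp
        | cons x l ih =>
          rw [List.map_cons, List.map_cons, List.map_cons, List.map_cons, List.prod_cons,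
            List.prod_cons, List.prod_cons, Polynomial.mul_coeff_zero, ih, ← smul_mul_smul_comm]
          congr 1
          by_cases hqx : q x
          · rw [show P x = _ from if_pos hqx, show sign x = _ from if_pos hqx,
              show low x = _ from if_pos hqx, Polynomial.mul_coeff_zero, Polynomial.coeff_C_zero,
              Algebra.smul_def, map_intCast, Polynomial.intCast_coeff_zero]
          · rw [show P x = _ from if_neg hqx, show sign x = _ from if_neg hqx,
              show low x = _ from if_neg hqx]
            simp
      have := (hg.linearIndependent.comp ψ hψ).units_smul
        fun m ↦ Units.mk0 _ (hsign m.1.1 m.1.2.2)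
      have heq : (fun m : {m : StdMonomial δ δ' // m.1.countP q = n} ↦
          (m.1.1.map P).prod.coeff 0) = _ := funext fun m ↦ hP m.1.1
      rw [heq]
      exact this

theorem exists_isSpinorParametrization {δ δ' : AffWeight} (h : δ ≤ δ') :
    ∃ (B : Type) (_ : CommRing B) (_ : IsDomain B) (_ : Algebra ℂ B) (g : SpinWeight → B[T;T⁻¹])
      (n : ℕ), IsSpinorParametrization δ δ' g ∧ Algebra.trdeg ℂ B = n ∧
        (n : ℤ) = ht δ' - ht δ + 1 := by
  change Relation.ReflTransGen Arrow δ δ' at h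
  induction h with
  | refl =>
    exact ⟨Polynomial ℂ, inferInstance, inferInstance, inferInstance, _, 1,
      isSpinorParametrization_self δ, by simp [Polynomial.trdeg_of_isDomain], by simp⟩
  | @tail x y hx hxy ih =>
    obtain ⟨B, _, _, _, g, n, hg, hB, hn⟩ := ih
    obtain ⟨i, hi, rfl⟩ := AffineNode.exists_of_arrow hxy
    refine ⟨Polynomial B, inferInstance, inferInstance, inferInstance, _, n + 1, hg.act hi hx,
      ?_, ?_⟩
    · rw [← trdeg_add_eq (R := ℂ) (S := B), hB, Polynomial.trdeg_of_isDomain]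
      simp
    · have := hxy.ht_eq
      push_cast
      omega

end

/-! ### Embedding into a domain, and Krull dimension. -/

section

open AffWeight LaurentPolynomial

variable {δ δ' : AffWeight}

/-- A family of Laurent polynomials over `B` that satisfies the equations of the cone of pure
spinors, with coefficients supported on `[δ, δ']`, is a `B`-point of the Richardson algebra. -/
theorem exists_richardsonAlgebra_algHom {B : Type*} [CommRing B] [Algebra ℂ B]
    {g : SpinWeight → B[T;T⁻¹]} (hg : ∀ s, pureSpinorQuadric g s = 0)
    (hs : ∀ x ∉ Set.Icc δ δ', (g x.wt).coeff x.lvl = 0) :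
    ∃ φ : RichardsonAlgebra δ δ' →ₐ[ℂ] B,
      ∀ x, φ (richardsonCoord δ δ' x) = (g x.wt).coeff x.lvl := by
  set f : RichardsonPoly δ δ' →ₐ[ℂ] B :=
    MvPolynomial.aeval fun x : Set.Icc δ δ' ↦ (g x.1.wt).coeff x.1.lvl
  have hf (x : AffWeight) : f (richardsonVar δ δ' x) = (g x.wt).coeff x.lvl := by
    by_cases hx : x ∈ Set.Icc δ δ'
    · rw [richardsonVar_of_mem hx, MvPolynomial.aeval_X]
    · rw [richardsonVar_of_notMem hx, map_zero, hs x hx]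
  have hgen : (fun α ↦ AddMonoidAlgebra.mapRingHom ℤ (f : RichardsonPoly δ δ' →+* B)
      (richardsonGen δ δ' α)) = g := by
    funext α
    ext l
    simp [coeff_richardsonGen, hf]
  have hI (p : RichardsonPoly δ δ') (hp : p ∈ richardsonIdeal δ δ') : f p = 0 := by
    have : richardsonIdeal δ δ' ≤ RingHom.ker f := by
      refine Ideal.span_le.mpr ?_
      rintro _ ⟨s, l, rfl⟩
      have h : (AddMonoidAlgebra.mapRingHom ℤ (f : RichardsonPoly δ δ' →+* B)
          (pureSpinorQuadric (richardsonGen δ δ') s)).coeff l = 0 := by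
        rw [map_pureSpinorQuadric, hgen, hg]
        simp
      rw [AddMonoidAlgebra.coeff_mapRingHom] at h
      exact h
    exact this hp
  exact ⟨Ideal.Quotient.liftₐ _ f hI, fun x ↦ hf x⟩

theorem LinearMap.injective_of_span_of_linearIndependent {K V W ι : Type*} [Ring K]
    [AddCommGroup V] [Module K V] [AddCommGroup W] [Module K W] (f : V →ₗ[K] W) {v : ι → V}
    (hv : Submodule.span K (Set.range v) = ⊤) (hf : LinearIndependent K fun i ↦ f (v i)) :
    Function.Injective f := by
  rw [injective_iff_map_eq_zero]
  intro x hx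
  obtain ⟨c, rfl⟩ := Finsupp.mem_span_range_iff_exists_finsupp.mp (hv ▸ Submodule.mem_top (x := x))
  have : c = 0 := by
    refine linearIndependent_iff.mp hf c ?_
    rw [Finsupp.linearCombination_apply, ← hx, map_finsuppSum]
    simp
  simp [this]

/-- The Richardson algebra embeds into a domain of transcendence degree `ht δ' - ht δ + 1`. -/
theorem exists_richardsonAlgebra_embedding (h : δ ≤ δ') :
    ∃ (B : Type) (_ : CommRing B) (_ : IsDomain B) (_ : Algebra ℂ B)
      (φ : RichardsonAlgebra δ δ' →ₐ[ℂ] B) (n : ℕ), Function.Injective φ ∧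
        (∀ x ∈ Set.Icc δ δ', richardsonCoord δ δ' x ≠ 0) ∧
        Algebra.trdeg ℂ B = n ∧ (n : ℤ) = ht δ' - ht δ + 1 := by
  obtain ⟨B, _, _, _, g, n, hg, hB, hn⟩ := exists_isSpinorParametrization h
  obtain ⟨φ, hφ⟩ := exists_richardsonAlgebra_algHom hg.quadric hg.support
  refine ⟨B, inferInstance, inferInstance, inferInstance, φ, n, ?_, fun x hx h0 ↦ ?_, hB, hn⟩
  · refine LinearMap.injective_of_span_of_linearIndependent φ.toLinearMap
      span_stdMonomial_eq_top ?_
    have heq (m : StdMonomial δ δ') :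
        φ.toLinearMap (m.1.map (richardsonCoord δ δ')).prod =
          (m.1.map fun x ↦ (g x.wt).coeff x.lvl).prod := by
      rw [AlgHom.toLinearMap_apply, map_list_prod, List.map_map]
      exact congrArg (fun f ↦ (m.1.map f).prod) (funext hφ)
    rw [funext heq]
    exact hg.linearIndependent
  · refine hg.linearIndependent.ne_zero ⟨[x], by simp, by simpa using hx⟩ ?_
    rw [List.map_singleton, List.prod_singleton, ← hφ, h0, map_zero]

theorem isDomain_richardsonAlgebra (h : δ ≤ δ') : IsDomain (RichardsonAlgebra δ δ') := by
  obtain ⟨B, _, _, _, φ, -, hφ, -⟩ := exists_richardsonAlgebra_embedding h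
  exact hφ.isDomain φ.toRingHom

theorem richardsonCoord_ne_zero (h : δ ≤ δ') {x : AffWeight} (hx : x ∈ Set.Icc δ δ') :
    richardsonCoord δ δ' x ≠ 0 := by
  obtain ⟨B, _, _, _, -, -, -, h', -⟩ := exists_richardsonAlgebra_embedding h
  exact h' x hx

theorem RingHom.IsIntegral.ringKrullDim_le {R S : Type*} [CommRing R] [CommRing S] {f : R →+* S}
    (hf : f.IsIntegral) : ringKrullDim S ≤ ringKrullDim R := by
  algebraize [f]
  have : Algebra.IsIntegral R S := ⟨hf⟩
  exact Order.krullDim_le_of_strictMono (PrimeSpectrum.comap (algebraMap R S))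
    fun p q hpq ↦ Ideal.IsIntegral.comap_lt_comap hpq

/-- The dimension of an algebra of finite type is bounded by the transcendence degree of any
algebra into which it embeds. -/
theorem ringKrullDim_le_of_trdeg_eq {K A : Type*} {B : Type*} [Field K] [CommRing A] [Nontrivial A]
    [Algebra K A] [Algebra.FiniteType K A] [CommRing B] [Algebra K B] {φ : A →ₐ[K] B}
    (hφ : Function.Injective φ) {n : ℕ} (hn : Algebra.trdeg K B = n) : ringKrullDim A ≤ n := by
  -- Noether normalization: `A` is integral over a polynomial ring in `s` variables, whose images in
  -- `B` are algebraically independent, so `s ≤ n`.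
  obtain ⟨s, f, hf, hint⟩ := exists_integral_inj_algHom_of_fg K A
  refine hint.ringKrullDim_le.trans ?_
  rw [MvPolynomial.ringKrullDim_of_isNoetherianRing, ringKrullDim_eq_zero_of_field, zero_add,
    Nat.card_fin]
  have h : AlgebraicIndependent K fun i ↦ φ (f (MvPolynomial.X i)) := by
    have := (MvPolynomial.algebraicIndependent_X (Fin s) K).map' (f := φ.comp f) (hφ.comp hf)
    exact this
  have hs := h.lift_cardinalMk_le_trdeg
  rw [hn] at hs
  simp only [Cardinal.mk_fin, Cardinal.lift_natCast] at hs
  exact_mod_cast hs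

/-- The map sets the variables outside `[ε, δ']` to zero: coordinates of the smaller interval,
extended by zero, satisfy the relations of the larger one. -/
theorem exists_richardsonAlgebra_surjection {ε : AffWeight} (hδ : ¬ ε ≤ δ) (h : δ ≤ ε) :
    ∃ φ : RichardsonAlgebra δ δ' →+* RichardsonAlgebra ε δ', Function.Surjective φ ∧
      φ (richardsonCoord δ δ' δ) = 0 := by
  have hquad (s : VecWeight) : pureSpinorQuadric (fun α ↦ AddMonoidAlgebra.mapRingHom ℤ
      (Ideal.Quotient.mk (richardsonIdeal ε δ')) (richardsonGen ε δ' α)) s = 0 := by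
    rw [← map_pureSpinorQuadric]
    ext l
    rw [AddMonoidAlgebra.coeff_mapRingHom]
    exact Ideal.Quotient.eq_zero_iff_mem.mpr (Ideal.subset_span ⟨s, l, rfl⟩)
  have hcoeff (x : AffWeight) : (AddMonoidAlgebra.mapRingHom ℤ
      (Ideal.Quotient.mk (richardsonIdeal ε δ')) (richardsonGen ε δ' x.wt)).coeff x.lvl =
      richardsonCoord ε δ' x := by
    simp [coeff_richardsonGen, richardsonCoord]
  obtain ⟨φ, hφ⟩ := exists_richardsonAlgebra_algHom (δ := δ) (δ' := δ') hquad fun x hx ↦ by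
    rw [hcoeff]
    exact richardsonCoord_of_notMem fun h' ↦ hx ⟨h.trans h'.1, h'.2⟩
  refine ⟨φ, fun f ↦ ?_, ?_⟩
  · obtain ⟨p, rfl⟩ := Ideal.Quotient.mk_surjective f
    induction p using MvPolynomial.induction_on with
    | C c => exact ⟨algebraMap ℂ _ c, φ.commutes c⟩
    | add p q hp hq =>
      obtain ⟨a, ha⟩ := hp
      obtain ⟨b, hb⟩ := hq
      exact ⟨a + b, by rw [map_add, ha, hb, map_add]⟩
    | mul_X p i hp =>
      obtain ⟨a, ha⟩ := hp
      refine ⟨a * richardsonCoord δ δ' i, ?_⟩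
      rw [map_mul, ha, map_mul]
      congr 1
      refine ((hφ i).trans (hcoeff i)).trans ?_
      rw [richardsonCoord, richardsonVar_of_mem i.2]
  · refine ((hφ δ).trans (hcoeff δ)).trans (richardsonCoord_of_notMem fun h' ↦ hδ h'.1)

theorem le_ringKrullDim_richardsonAlgebra (h : δ ≤ δ') {n : ℕ} (hn : (n : ℤ) = ht δ' - ht δ + 1) :
    n ≤ ringKrullDim (RichardsonAlgebra δ δ') := by
  have hne {δ : AffWeight} (h : δ ≤ δ') :
      richardsonCoord δ δ' δ ∈ nonZeroDivisors (RichardsonAlgebra δ δ') :=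
    have := isDomain_richardsonAlgebra h
    mem_nonZeroDivisors_of_ne_zero (richardsonCoord_ne_zero h ⟨le_rfl, h⟩)
  have h' : Relation.ReflTransGen Arrow δ δ' := h
  induction h' using Relation.ReflTransGen.head_induction_on generalizing n with
  | refl =>
    obtain rfl : n = 1 := by omega
    -- The vertex of the cone gives a map onto `ℂ` that kills the nonzero coordinate at `δ'`; this
    -- accounts for the `+ 1`.
    obtain ⟨φ, hφ⟩ := exists_richardsonAlgebra_algHom (δ := δ') (δ' := δ') (B := ℂ) (g := 0)
      (fun s ↦ by cases s <;> simp [pureSpinorQuadric]) (fun x _ ↦ by simp)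
    refine le_trans ?_ (ringKrullDim_succ_le_of_surjective φ.toRingHom
      (fun c ↦ ⟨algebraMap ℂ _ c, φ.commutes c⟩) (hne le_rfl) ((hφ δ').trans (by simp)))
    rw [ringKrullDim_eq_zero_of_field]
    simp
  | @head x y hxy hy ih =>
    have hht := hxy.ht_eq
    obtain ⟨k, rfl⟩ : ∃ k, n = k + 1 := by
      have := ht_mono (show y ≤ δ' from hy)
      exact ⟨n - 1, by omega⟩
    have hle : x ≤ y := Relation.ReflTransGen.single hxy
    obtain ⟨φ, hφ, hφ0⟩ := exists_richardsonAlgebra_surjection (δ' := δ')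
      (fun h ↦ by have := ht_mono h; omega) hle
    refine le_trans ?_ (ringKrullDim_succ_le_of_surjective φ hφ (hne h) hφ0)
    push_cast
    gcongr
    exact ih hy (by push_cast at hn; omega)

end

theorem propositionP (δ δ' : AffWeight) (hδ : δ ≤ δ') :
    (AlgebraicGeometry.IsAffine
        (AlgebraicGeometry.Spec (CommRingCat.of (RichardsonAlgebra δ δ'))) ∧
      AlgebraicGeometry.IsReduced
        (AlgebraicGeometry.Spec (CommRingCat.of (RichardsonAlgebra δ δ')))) ∧
    ∃ d : ℕ, (d : ℤ) = AffWeight.ht δ' - AffWeight.ht δ + 1 ∧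
      topologicalKrullDim
        (AlgebraicGeometry.Spec (CommRingCat.of (RichardsonAlgebra δ δ'))) = d := by
  have hdom := isDomain_richardsonAlgebra hδ
  have : IsReduced (CommRingCat.of (RichardsonAlgebra δ δ')) :=
    inferInstanceAs (IsReduced (RichardsonAlgebra δ δ'))
  refine ⟨⟨inferInstance, inferInstance⟩, ?_⟩
  obtain ⟨B, _, _, _, φ, n, hφ, -, hB, hn⟩ := exists_richardsonAlgebra_embedding hδ
  refine ⟨n, hn, ?_⟩
  -- Finiteness of the interval makes the algebra of finite type, as Noether normalization requires.
  have hfin : Finite (Set.Icc δ δ') := by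
    refine Finite.of_injective
      (fun x : Set.Icc δ δ' ↦ ((⟨x.1.left, ?_⟩, ⟨x.1.right, ?_⟩) :
        Set.Icc δ.left δ'.left × Set.Icc δ.right δ'.right)) fun x y hxy ↦ ?_
    · exact ⟨(AffWeight.le_iff.mp x.2.1).1, (AffWeight.le_iff.mp x.2.2).1⟩
    · exact ⟨(AffWeight.le_iff.mp x.2.1).2, (AffWeight.le_iff.mp x.2.2).2⟩
    · rw [Prod.mk.injEq, Subtype.ext_iff, Subtype.ext_iff] at hxy
      exact Subtype.ext (AffWeight.eq_of_left_right hxy.1 hxy.2)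
  have hdim : ringKrullDim (RichardsonAlgebra δ δ') = n :=
    le_antisymm (ringKrullDim_le_of_trdeg_eq hφ hB) (le_ringKrullDim_richardsonAlgebra hδ hn)
  exact (PrimeSpectrum.topologicalKrullDim_eq_ringKrullDim _).trans hdim
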